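/- Let $a<b$ and let $f:[a,b]\to\mathbb R$ be strictly increasing, of class $C^2$ and strongly concave: for some $\delta>0$, $f''(p)\le-\delta$ for all $p\in[a,b]$. Let $\psi:\mathbb R\to\mathbb R$ be Lipschitz continuous and $1$-periodic, with $\psi'(t)\in[-f(b),-f(a)]$ for a.e. $t\in\mathbb R$. Consider the problem $$\begin{cases}\partial_x w\in[a,b] & \text{a.e. in }\mathbb R\times(0,+\infty),\\ \partial_t w+f(\partial_x w)=0 & \text{in }\mathbb R\times(0,+\infty),\\ w(t,0)=\psi(t) & \text{for all }t\in\mathbb R,\end{cases}$$ where the equation in the second line is understood in the viscosity sense. Then this problem has exactly one solution $w:\mathbb R\times[0,+\infty)\to\mathbb R$ that is (globally) Lipschitz continuous and $1$-periodic in $t$. It is given, for all $t\in\mathbb R$ and $x\ge0$, by $$w(t,x)=\sup_{t_1\le t}\bigl\{\psi(t_1)-\xi(t-t_1,x)\bigr\},\qquad\text{where}\qquad \xi(s,y)=\max_{p\in[a,b]}\bigl\{-py+s f(p)\bigr\}\quad(s,y\ge0).$$ -/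

import Mathlib

open Set Filter Topology MeasureTheory
open scoped NNReal

/-- The closed half-plane `ℝ × [0, ∞)` of points `(t, x)`. -/
def halfPlane : Set (ℝ × ℝ) := univ ×ˢ Ici 0

/-- The open half-plane `ℝ × (0, ∞)` of points `(t, x)`. -/
def openHalfPlane : Set (ℝ × ℝ) := univ ×ˢ Ioi 0

/-- `w` is a viscosity subsolution of `∂ₜ w + f (∂ₓ w) = 0` in the open set `Ω` of points
`(t, x)`: whenever a `C¹` test function `φ` touches `w` from above (up to a constant), it satisfies
`∂ₜ φ + f (∂ₓ φ) ≤ 0` at the contact point. -/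
def IsViscositySubsolution (f : ℝ → ℝ) (Ω : Set (ℝ × ℝ)) (w : ℝ × ℝ → ℝ) : Prop :=
  ∀ φ : ℝ × ℝ → ℝ, ContDiffOn ℝ 1 φ Ω → ∀ z ∈ Ω, IsLocalMax (fun y => w y - φ y) z →
    fderiv ℝ φ z (1, 0) + f (fderiv ℝ φ z (0, 1)) ≤ 0

/-- `w` is a viscosity supersolution of `∂ₜ w + f (∂ₓ w) = 0` in the open set `Ω` of points
`(t, x)`: whenever a `C¹` test function `φ` touches `w` from below (up to a constant), it satisfies
`∂ₜ φ + f (∂ₓ φ) ≥ 0` at the contact point. -/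
def IsViscositySupersolution (f : ℝ → ℝ) (Ω : Set (ℝ × ℝ)) (w : ℝ × ℝ → ℝ) : Prop :=
  ∀ φ : ℝ × ℝ → ℝ, ContDiffOn ℝ 1 φ Ω → ∀ z ∈ Ω, IsLocalMin (fun y => w y - φ y) z →
    0 ≤ fderiv ℝ φ z (1, 0) + f (fderiv ℝ φ z (0, 1))

/-- `w` is a Lipschitz continuous viscosity solution, `1`-periodic in time, of
`∂ₓ w ∈ [a, b]` a.e. in `ℝ × (0, ∞)`, `∂ₜ w + f (∂ₓ w) = 0` in `ℝ × (0, ∞)`,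
`w (t, 0) = ψ t` for all `t`.
Only the values of `w` on `ℝ × [0, ∞)` matter, and only the values of `f` on `[a, b]`: by
`slope_mem`, the gradient `∂ₓ φ` of any function `φ` touching `w` lies in `[a, b]`. -/
structure IsPeriodicHJSolution (f : ℝ → ℝ) (a b : ℝ) (ψ : ℝ → ℝ) (w : ℝ × ℝ → ℝ) : Prop where
  lipschitz : ∃ K : ℝ≥0, LipschitzOnWith K w halfPlane
  periodic : ∀ t x : ℝ, 0 ≤ x → w (t + 1, x) = w (t, x)
  slope_mem : ∀ᵐ z ∂(volume.restrict openHalfPlane),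
    ∃ p ∈ Icc a b, HasDerivAt (fun y => w (z.1, y)) p z.2
  subsolution : IsViscositySubsolution f openHalfPlane w
  supersolution : IsViscositySupersolution f openHalfPlane w
  boundary : ∀ t : ℝ, w (t, 0) = ψ t

/-- `ξ (s, y) = max_{p ∈ [a, b]} (- p y + s f p)`. -/
noncomputable def xi (f : ℝ → ℝ) (a b s y : ℝ) : ℝ :=
  sSup ((fun p => -p * y + s * f p) '' Icc a b)

/-- The supremum defining `xi` is an attained maximum. -/
theorem isGreatest_xi {f : ℝ → ℝ} {a b : ℝ} (hab : a ≤ b) (hf : ContinuousOn f (Icc a b))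
    (s y : ℝ) : IsGreatest ((fun p => -p * y + s * f p) '' Icc a b) (xi f a b s y) := by
  have hc : ContinuousOn (fun p => -p * y + s * f p) (Icc a b) := by fun_prop
  exact (isCompact_Icc.image_of_continuousOn hc).isGreatest_sSup
    ((nonempty_Icc.2 hab).image _)

/-! Since `f` is strictly increasing, `x` can play the role of time. For uniqueness, two solutions
are compared by doubling variables with the extra penalty `l * x ^ 2`: at an interior maximum both
test functions have the same `t`-derivative, while the `x`-slope for the subsolution is larger by `2
* l * x`. Both slopes lie in `[a, b]`, so strict monotonicity of `f` contradicts the two viscosity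
inequalities (`viscosity_comparison`).

For existence, `xi` is a maximum of linear functions, hence subadditive and positively homogeneous.
Subadditivity gives one half of dynamic programming, and testing it along a supergradient direction
of `f` gives the supersolution property. Homogeneity makes the segment towards an optimal `t₁`
optimal as well, which gives the subsolution property. The bounds on `ψ'` make the supremum finite,
fix the boundary value and bound the `t`-slopes. -/

/-! ### Slope bounds on the half-plane -/

/-- A Lipschitz function whose derivative lies a.e. in `[a, b]` has its increments between those
of slopes `a` and `b`. -/
theorem LipschitzOnWith.sub_mem_Icc_of_ae_hasDerivAt {g : ℝ → ℝ} {K : ℝ≥0} {a b x y : ℝ}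
    (hxy : x ≤ y) (hg : LipschitzOnWith K g (Icc x y))
    (hd : ∀ᵐ s : ℝ, s ∈ Ioo x y → ∃ p ∈ Icc a b, HasDerivAt g p s) :
    g y - g x ∈ Icc (a * (y - x)) (b * (y - x)) := by
  have hac : AbsolutelyContinuousOnInterval g x y :=
    LipschitzOnWith.absolutelyContinuousOnInterval (by rwa [uIcc_of_le hxy])
  have hd' : ∀ᵐ s ∂volume.restrict (Icc x y), deriv g s ∈ Icc a b := by
    rw [← restrict_Ioo_eq_restrict_Icc, ae_restrict_iff' measurableSet_Ioo]
    filter_upwards [hd] with s hs hsx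
    obtain ⟨p, hp, h⟩ := hs hsx
    rwa [h.deriv]
  have hi := hac.intervalIntegrable_deriv
  rw [← hac.integral_deriv_eq_sub]
  have h1 := intervalIntegral.integral_mono_ae_restrict hxy (f := fun _ => a) (by simp) hi
    (hd'.mono fun s hs => hs.1)
  have h2 := intervalIntegral.integral_mono_ae_restrict hxy (g := fun _ => b) hi (by simp)
    (hd'.mono fun s hs => hs.2)
  simp only [intervalIntegral.integral_const, smul_eq_mul] at h1 h2
  constructor <;> linarith

theorem LipschitzWith.sub_mem_Icc_of_ae_deriv {g : ℝ → ℝ} {K : ℝ≥0} {a b x y : ℝ}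
    (hxy : x ≤ y) (hg : LipschitzWith K g) (hd : ∀ᵐ s : ℝ, deriv g s ∈ Icc a b) :
    g y - g x ∈ Icc (a * (y - x)) (b * (y - x)) := by
  refine LipschitzOnWith.sub_mem_Icc_of_ae_hasDerivAt hxy hg.lipschitzOnWith ?_
  filter_upwards [hd, hg.ae_differentiableAt] with s hs hs' _
  exact ⟨_, hs, hs'.hasDerivAt⟩

theorem isOpen_openHalfPlane : IsOpen openHalfPlane := isOpen_univ.prod isOpen_Ioi

theorem mem_openHalfPlane {t x : ℝ} : (t, x) ∈ openHalfPlane ↔ 0 < x := by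
  simp [openHalfPlane]

theorem mem_halfPlane {t x : ℝ} : (t, x) ∈ halfPlane ↔ 0 ≤ x := by
  simp [halfPlane]

theorem LipschitzOnWith.abs_sub_le_of_halfPlane {w : ℝ × ℝ → ℝ} {K : ℝ≥0}
    (hw : LipschitzOnWith K w halfPlane) {t x s y : ℝ} (hx : 0 ≤ x) (hy : 0 ≤ y) :
    |w (t, x) - w (s, y)| ≤ K * |t - s| + K * |x - y| := by
  have h := hw.dist_le_mul (t, x) (mem_halfPlane.2 hx) (s, y) (mem_halfPlane.2 hy)
  rw [Real.dist_eq, Prod.dist_eq, Real.dist_eq, Real.dist_eq] at h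
  refine h.trans ?_
  rw [← mul_add]
  exact mul_le_mul_of_nonneg_left (max_le_add_of_nonneg (abs_nonneg _) (abs_nonneg _)) K.2

/-- `w` has slopes in `[a, b]` in its second variable on the half-plane. -/
def HasSlopesIn (a b : ℝ) (w : ℝ × ℝ → ℝ) : Prop :=
  ∀ t x y : ℝ, 0 ≤ x → x ≤ y → w (t, y) - w (t, x) ∈ Icc (a * (y - x)) (b * (y - x))

/-- By Fubini the slope condition holds a.e. on almost every line of constant `t`, where it
integrates. Continuity in `t` and density of a full-measure set extend the bound to every `t`. -/
theorem IsPeriodicHJSolution.hasSlopesIn {f ψ : ℝ → ℝ} {a b : ℝ} {w : ℝ × ℝ → ℝ}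
    (hw : IsPeriodicHJSolution f a b ψ w) : HasSlopesIn a b w := by
  obtain ⟨K, hK⟩ := hw.lipschitz
  intro t x y hx hxy
  have hae : ∀ᵐ t : ℝ, ∀ᵐ s ∂(volume.restrict (Ioi (0 : ℝ))),
      ∃ p ∈ Icc a b, HasDerivAt (fun y => w (t, y)) p s := by
    have h := hw.slope_mem
    rw [openHalfPlane, Measure.volume_eq_prod, ← Measure.prod_restrict, Measure.restrict_univ] at h
    exact Measure.ae_ae_of_ae_prod h
  have hae2 : ∀ᵐ t : ℝ, w (t, y) - w (t, x) ∈ Icc (a * (y - x)) (b * (y - x)) := by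
    filter_upwards [hae] with t ht
    refine LipschitzOnWith.sub_mem_Icc_of_ae_hasDerivAt (g := fun y => w (t, y)) (K := K) hxy ?_ ?_
    · refine LipschitzOnWith.of_dist_le_mul fun s hs r hr => ?_
      have := hK.abs_sub_le_of_halfPlane (t := t) (s := t) (hx.trans hs.1) (hx.trans hr.1)
      simpa [Real.dist_eq] using this
    · rw [ae_restrict_iff' measurableSet_Ioi] at ht
      filter_upwards [ht] with s hs hsx
      exact hs (hx.trans_lt hsx.1)
  have hcont : ∀ z : ℝ, 0 ≤ z → Continuous fun t => w (t, z) := fun z hz =>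
    (LipschitzWith.of_dist_le_mul (K := K) fun s r => by
      have := hK.abs_sub_le_of_halfPlane (t := s) (s := r) hz hz
      simpa [Real.dist_eq] using this).continuous
  have hcl : IsClosed {t | w (t, y) - w (t, x) ∈ Icc (a * (y - x)) (b * (y - x))} :=
    isClosed_Icc.preimage ((hcont y (hx.trans hxy)).sub (hcont x hx))
  have := (Measure.dense_of_ae hae2).closure_eq
  rw [hcl.closure_eq] at this
  exact this.ge (mem_univ t)

/-! ### Derivatives of test functions at contact points -/

/-- Restriction of a local maximum of `w - φ` to a ray. -/
theorem le_fderiv_of_isLocalMax {w φ : ℝ × ℝ → ℝ} {z d : ℝ × ℝ} {c : ℝ}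
    (hφ : DifferentiableAt ℝ φ z) (hmax : IsLocalMax (fun y => w y - φ y) z)
    (hc : ∃ᶠ h in 𝓝[>] (0 : ℝ), c * h ≤ w (z + h • d) - w z) : c ≤ fderiv ℝ φ z d := by
  have hd : HasDerivAt (fun h : ℝ => φ (z + h • d)) (fderiv ℝ φ z d) 0 :=
    HasFDerivAt.hasLineDerivAt hφ.hasFDerivAt d
  have ht := (hasDerivAt_iff_tendsto_slope_zero.1 hd).mono_left
    (nhdsWithin_mono 0 (fun h (hh : 0 < h) => hh.ne'))
  have hcont : Tendsto (fun h : ℝ => z + h • d) (𝓝[>] 0) (𝓝 z) := by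
    have : Continuous fun h : ℝ => z + h • d := by fun_prop
    simpa using (this.tendsto 0).mono_left nhdsWithin_le_nhds
  refine ge_of_tendsto_of_frequently ht ?_
  refine (hc.and_eventually ((hcont.eventually hmax).and self_mem_nhdsWithin)).mono ?_
  rintro h ⟨h1, h2, h3⟩
  have h3' : 0 < h := h3
  simp only [zero_add, zero_smul, add_zero, smul_eq_mul]
  rw [inv_mul_eq_div, le_div_iff₀ h3']
  linarith

theorem fderiv_le_of_isLocalMin {w φ : ℝ × ℝ → ℝ} {z d : ℝ × ℝ} {c : ℝ}
    (hφ : DifferentiableAt ℝ φ z) (hmin : IsLocalMin (fun y => w y - φ y) z)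
    (hc : ∃ᶠ h in 𝓝[>] (0 : ℝ), w (z + h • d) - w z ≤ c * h) : fderiv ℝ φ z d ≤ c := by
  have h := le_fderiv_of_isLocalMax (w := fun y => -w y) (φ := fun y => -φ y) (d := d) (c := -c)
    hφ.neg (by
      filter_upwards [hmin] with y hy
      linarith) (hc.mono fun h hh => by linarith)
  rw [fderiv_fun_neg] at h
  simpa using h

theorem eventually_nhdsGT_zero_le {x : ℝ} (hx : 0 < x) :
    ∀ᶠ h in 𝓝[>] (0 : ℝ), 0 < h ∧ h ≤ x := by
  filter_upwards [Ioc_mem_nhdsGT hx] with h hh using hh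

/-- Each bound uses one ray: upward in `x` for `a`, downward for `b`. The downward ray has room
because `0 < x`. -/
theorem HasSlopesIn.fderiv_mem_of_isLocalMax {w φ : ℝ × ℝ → ℝ} {a b t x : ℝ}
    (hw : HasSlopesIn a b w) (hx : 0 < x) (hφ : DifferentiableAt ℝ φ (t, x))
    (hmax : IsLocalMax (fun y => w y - φ y) (t, x)) : fderiv ℝ φ (t, x) (0, 1) ∈ Icc a b := by
  constructor
  · refine le_fderiv_of_isLocalMax hφ hmax (Eventually.frequently ?_)
    filter_upwards [eventually_nhdsGT_zero_le hx] with h hh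
    have := (hw t x (x + h) hx.le (by linarith)).1
    simpa using this
  · have : -b ≤ fderiv ℝ φ (t, x) (0, -1) := by
      refine le_fderiv_of_isLocalMax hφ hmax (Eventually.frequently ?_)
      filter_upwards [eventually_nhdsGT_zero_le hx] with h hh
      have := (hw t (x - h) x (by linarith) (by linarith)).2
      simp only [sub_sub_cancel] at this
      simp only [Prod.smul_mk, smul_eq_mul, mul_zero, mul_neg, mul_one, Prod.mk_add_mk, add_zero,
        ← sub_eq_add_neg]
      linarith
    have h2 : ((0 : ℝ), (-1 : ℝ)) = -(0, 1) := by simp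
    rw [h2, map_neg] at this
    linarith

theorem HasSlopesIn.fderiv_mem_of_isLocalMin {w φ : ℝ × ℝ → ℝ} {a b t x : ℝ}
    (hw : HasSlopesIn a b w) (hx : 0 < x) (hφ : DifferentiableAt ℝ φ (t, x))
    (hmin : IsLocalMin (fun y => w y - φ y) (t, x)) : fderiv ℝ φ (t, x) (0, 1) ∈ Icc a b := by
  have hw' : HasSlopesIn (-b) (-a) (fun y => -w y) := fun t x y hx hxy => by
    obtain ⟨h1, h2⟩ := hw t x y hx hxy
    constructor <;> linarith
  have h := hw'.fderiv_mem_of_isLocalMax (φ := fun y => -φ y) hx hφ.neg (by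
    filter_upwards [hmin] with y hy
    linarith)
  rw [fderiv_fun_neg] at h
  simp only [neg_apply, mem_Icc] at h
  constructor <;> linarith

/-! ### Concavity of `f` -/

/-- A function that is increasing, concave and differentiable on `[a, b]` has a nonnegative
supergradient at each point of `[a, b]`. -/
theorem exists_nonneg_supergradient {f : ℝ → ℝ} {a b p : ℝ} (hf : MonotoneOn f (Icc a b))
    (hconc : ConcaveOn ℝ (Icc a b) f) (hd : DifferentiableOn ℝ f (Icc a b)) (hp : p ∈ Icc a b) :
    ∃ m : ℝ, 0 ≤ m ∧ ∀ p' ∈ Icc a b, f p' ≤ f p + m * (p' - p) := by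
  refine ⟨derivWithin f (Icc a b) p, hf.derivWithin_nonneg, fun p' hp' => ?_⟩
  have hfp := (hd p hp).hasDerivWithinAt
  rcases lt_trichotomy p p' with h | rfl | h
  · have := hconc.slope_le_of_hasDerivWithinAt hp hp' h hfp
    rw [slope_def_field, div_le_iff₀ (by linarith)] at this
    linarith
  · simp
  · have := hconc.le_slope_of_hasDerivWithinAt hp' hp h hfp
    rw [slope_def_field, le_div_iff₀ (by linarith)] at this
    linarith

theorem concaveOn_Icc_of_iteratedDerivWithin_two_nonpos {f : ℝ → ℝ} {a b : ℝ} (hab : a < b)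
    (hf : ContDiffOn ℝ 2 f (Icc a b))
    (hf'' : ∀ p ∈ Icc a b, iteratedDerivWithin 2 f (Icc a b) p ≤ 0) :
    ConcaveOn ℝ (Icc a b) f := by
  have hu := uniqueDiffOn_Icc hab
  have hd1 := hf.differentiableOn (by norm_num)
  have hd2 : DifferentiableOn ℝ (derivWithin f (Icc a b)) (Icc a b) :=
    (hf.derivWithin hu (m := 1) (by norm_num)).differentiableOn (by norm_num)
  refine concaveOn_of_hasDerivWithinAt2_nonpos (convex_Icc a b) hf.continuousOn
    (f' := derivWithin f (Icc a b))
    (f'' := derivWithin (derivWithin f (Icc a b)) (Icc a b))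
    (fun x hx => ((hd1 x (interior_subset hx)).hasDerivWithinAt).mono interior_subset)
    (fun x hx => ((hd2 x (interior_subset hx)).hasDerivWithinAt).mono interior_subset)
    (fun x hx => ?_)
  have := hf'' x (interior_subset hx)
  rwa [iteratedDerivWithin_succ, iteratedDerivWithin_one] at this

/-! ### Comparison principle by doubling of variables -/

theorem fderiv_quadratic_penalty (A l s y t x : ℝ) :
    fderiv ℝ (fun z : ℝ × ℝ => A * ((z.1 - s) ^ 2 + (z.2 - y) ^ 2) + l * z.2 ^ 2) (t, x) (1, 0)
        = 2 * A * (t - s) ∧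
      fderiv ℝ (fun z : ℝ × ℝ => A * ((z.1 - s) ^ 2 + (z.2 - y) ^ 2) + l * z.2 ^ 2) (t, x) (0, 1)
        = 2 * A * (x - y) + 2 * l * x := by
  have h1 : HasFDerivAt (fun z : ℝ × ℝ => z.1) (ContinuousLinearMap.fst ℝ ℝ ℝ) (t, x) :=
    hasFDerivAt_fst
  have h2 : HasFDerivAt (fun z : ℝ × ℝ => z.2) (ContinuousLinearMap.snd ℝ ℝ ℝ) (t, x) :=
    hasFDerivAt_snd
  have h := ((((h1.sub_const s).pow 2).add ((h2.sub_const y).pow 2)).const_mul A).add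
    ((h2.pow 2).const_mul l)
  have e := h.fderiv
  constructor
  · refine (DFunLike.congr_fun e (1, 0)).trans ?_
    simp
    ring
  · refine (DFunLike.congr_fun e (0, 1)).trans ?_
    simp
    ring

/-- The doubled and penalised difference of two functions on the half-plane. -/
def doubled (v w : ℝ × ℝ → ℝ) (A l : ℝ) (z : (ℝ × ℝ) × (ℝ × ℝ)) : ℝ :=
  v z.1 - w z.2 - A * ((z.1.1 - z.2.1) ^ 2 + (z.1.2 - z.2.2) ^ 2) - l * z.1.2 ^ 2

/-- Equal boundary values leave only linear growth, which the quadratic penalties dominate. This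
confines the search for a maximum, up to a common translation of the two times. -/
theorem doubled_le {v w : ℝ × ℝ → ℝ} {K : ℝ≥0} (hv : LipschitzOnWith K v halfPlane)
    (hw : LipschitzOnWith K w halfPlane) (h0 : ∀ t, v (t, 0) = w (t, 0)) (A l : ℝ)
    {t x s y : ℝ} (hx : 0 ≤ x) (hy : 0 ≤ y) :
    doubled v w A l ((t, x), (s, y)) ≤ 2 * K * x + K * |x - y| + K * |t - s|
      - (A * (t - s) ^ 2 + A * (x - y) ^ 2 + l * x ^ 2) := by
  have h1 := (abs_le.1 (hv.abs_sub_le_of_halfPlane (t := t) (s := t) hx le_rfl)).2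
  have h2 := (abs_le.1 (hw.abs_sub_le_of_halfPlane (t := t) (s := s) le_rfl hy)).2
  have h3 : |(0 : ℝ) - y| ≤ |x - y| + x := by
    rw [abs_of_nonpos (by linarith)]
    linarith [neg_abs_le (x - y)]
  simp only [sub_self, abs_zero, sub_zero, abs_of_nonneg hx, mul_zero, zero_add] at h1
  have h4 := mul_le_mul_of_nonneg_left h3 K.coe_nonneg
  have := h0 t
  simp only [doubled]
  linarith

/-- If one point lies on the boundary, the common data turn `v - w` into an increment of a single
`K`-Lipschitz function. Each of the two terms `K * |r| - A * r ^ 2` is at most `K ^ 2 / (4 * A)`. -/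
theorem doubled_le_of_boundary {v w : ℝ × ℝ → ℝ} {K : ℝ≥0} (hv : LipschitzOnWith K v halfPlane)
    (hw : LipschitzOnWith K w halfPlane) (h0 : ∀ t, v (t, 0) = w (t, 0)) {A l : ℝ} (hA : 0 < A)
    (hl : 0 ≤ l) {t x s y : ℝ} (hx : 0 ≤ x) (hy : 0 ≤ y) (hxy : x = 0 ∨ y = 0) :
    doubled v w A l ((t, x), (s, y)) ≤ K ^ 2 / (2 * A) := by
  have h1 : v (t, x) - w (s, y) ≤ K * |t - s| + K * |x - y| := by
    rcases hxy with rfl | rfl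
    · rw [h0]
      exact (abs_le.1 (hw.abs_sub_le_of_halfPlane le_rfl hy)).2
    · rw [← h0]
      exact (abs_le.1 (hv.abs_sub_le_of_halfPlane hx le_rfl)).2
  have key : ∀ r : ℝ, K * |r| - A * r ^ 2 ≤ K ^ 2 / (4 * A) := fun r => by
    rw [le_div_iff₀ (by positivity), ← sq_abs r]
    nlinarith [sq_nonneg (2 * A * |r| - K)]
  have e : (K : ℝ) ^ 2 / (2 * A) = K ^ 2 / (4 * A) + K ^ 2 / (4 * A) := by
    field_simp
    ring
  have h2 : 0 ≤ l * x ^ 2 := by positivity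
  have := key (t - s)
  have := key (x - y)
  simp only [doubled]
  linarith

theorem doubled_add_int {v w : ℝ × ℝ → ℝ} (hv : ∀ t x : ℝ, 0 ≤ x → v (t + 1, x) = v (t, x))
    (hw : ∀ t x : ℝ, 0 ≤ x → w (t + 1, x) = w (t, x)) (A l : ℝ) {t x s y : ℝ} (hx : 0 ≤ x)
    (hy : 0 ≤ y) (n : ℤ) :
    doubled v w A l ((t - n, x), (s - n, y)) = doubled v w A l ((t, x), (s, y)) := by
  have h1 : v (t - n, x) = v (t, x) := by
    have : Function.Periodic (fun t => v (t, x)) 1 := fun t => hv t x hx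
    simpa using this.sub_int_mul_eq n (x := t)
  have h2 : w (s - n, y) = w (s, y) := by
    have : Function.Periodic (fun t => w (t, y)) 1 := fun t => hw t y hy
    simpa using this.sub_int_mul_eq n (x := s)
  simp only [doubled, h1, h2, sub_sub_sub_cancel_right]

theorem exists_isMax_doubled {v w : ℝ × ℝ → ℝ} {K : ℝ≥0} (hv : LipschitzOnWith K v halfPlane)
    (hw : LipschitzOnWith K w halfPlane) (hvp : ∀ t x : ℝ, 0 ≤ x → v (t + 1, x) = v (t, x))
    (hwp : ∀ t x : ℝ, 0 ≤ x → w (t + 1, x) = w (t, x)) (h0 : ∀ t, v (t, 0) = w (t, 0)) {A l : ℝ}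
    (hA : 0 < A) (hl : 0 < l) :
    ∃ t x s y : ℝ, 0 ≤ x ∧ 0 ≤ y ∧ ∀ t' x' s' y' : ℝ, 0 ≤ x' → 0 ≤ y' →
      0 < doubled v w A l ((t', x'), (s', y')) →
      doubled v w A l ((t', x'), (s', y')) ≤ doubled v w A l ((t, x), (s, y)) := by
  set m := min A l with hm
  have hm0 : 0 < m := lt_min hA hl
  -- Where `doubled` is positive, `T = |t - s| + |x - y| + x` satisfies `m * T ^ 2 / 3 ≤ 2 * K * T`.
  set R : ℝ := 6 * K / m with hR
  have hR0 : 0 ≤ R := by positivity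
  set B : Set ((ℝ × ℝ) × (ℝ × ℝ)) :=
    (Icc 0 1 ×ˢ Icc 0 R) ×ˢ (Icc (-(1 + R)) (1 + R) ×ˢ Icc 0 (2 * R)) with hB
  have hBc : IsCompact B :=
    (isCompact_Icc.prod isCompact_Icc).prod (isCompact_Icc.prod isCompact_Icc)
  have hBn : B.Nonempty :=
    ⟨((0, 0), (0, 0)), by simp only [hB, mem_prod, mem_Icc]; refine ⟨⟨?_, ?_⟩, ?_, ?_⟩ <;>
      constructor <;> linarith⟩
  have hcont : ContinuousOn (doubled v w A l) B := by
    have c1 : ContinuousOn (fun z : (ℝ × ℝ) × (ℝ × ℝ) => v z.1) B :=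
      hv.continuousOn.comp continuousOn_fst fun z hz => mem_halfPlane.2 hz.1.2.1
    have c2 : ContinuousOn (fun z : (ℝ × ℝ) × (ℝ × ℝ) => w z.2) B :=
      hw.continuousOn.comp continuousOn_snd fun z hz => mem_halfPlane.2 hz.2.2.1
    have c3 : Continuous fun z : (ℝ × ℝ) × (ℝ × ℝ) =>
        A * ((z.1.1 - z.2.1) ^ 2 + (z.1.2 - z.2.2) ^ 2) := by fun_prop
    have c4 : Continuous fun z : (ℝ × ℝ) × (ℝ × ℝ) => l * z.1.2 ^ 2 := by fun_prop
    exact ((c1.sub c2).sub c3.continuousOn).sub c4.continuousOn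
  obtain ⟨⟨⟨t, x⟩, ⟨s, y⟩⟩, hz, hmax⟩ := hBc.exists_isMaxOn hBn hcont
  refine ⟨t, x, s, y, hz.1.2.1, hz.2.2.1, fun t' x' s' y' hx' hy' hpos => ?_⟩
  -- Shifting both times by the same integer brings the first one into `[0, 1]`.
  rw [← doubled_add_int hvp hwp A l hx' hy' ⌊t'⌋] at hpos ⊢
  have ht0 : 0 ≤ t' - ⌊t'⌋ := sub_nonneg.2 (Int.floor_le t')
  have ht1 : t' - ⌊t'⌋ ≤ 1 := by linarith [Int.lt_floor_add_one t']
  generalize t' - (⌊t'⌋ : ℝ) = τ at *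
  generalize s' - (⌊t'⌋ : ℝ) = σ at *
  have hle := doubled_le hv hw h0 A l (t := τ) (s := σ) hx' hy'
  have hT : |τ - σ| + |x' - y'| + x' ≤ R := by
    have p1 : m * (τ - σ) ^ 2 ≤ A * (τ - σ) ^ 2 := by gcongr; exact min_le_left _ _
    have p2 : m * (x' - y') ^ 2 ≤ A * (x' - y') ^ 2 := by gcongr; exact min_le_left _ _
    have p3 : m * x' ^ 2 ≤ l * x' ^ 2 := by gcongr; exact min_le_right _ _
    have hr := abs_nonneg (τ - σ)
    have hu := abs_nonneg (x' - y')
    rw [← sq_abs] at p1 p2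
    have hr2 := sq_abs (τ - σ)
    have hu2 := sq_abs (x' - y')
    generalize |τ - σ| = r at *
    generalize |x' - y'| = u at *
    set T := r + u + x' with hTdef
    have hT0 : 0 ≤ T := by positivity
    have hK : (0 : ℝ) ≤ K := K.2
    have q1 : T ^ 2 ≤ 3 * (r ^ 2 + u ^ 2 + x' ^ 2) := by
      rw [hTdef]
      nlinarith [sq_nonneg (r - u), sq_nonneg (r - x'), sq_nonneg (u - x')]
    have q2 : m * T ^ 2 ≤ m * (3 * (r ^ 2 + u ^ 2 + x' ^ 2)) := by gcongr
    have q3 : m * T ^ 2 ≤ 6 * K * T := by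
      have := mul_nonneg hK hr
      have := mul_nonneg hK hu
      rw [← hr2, ← hu2] at hle
      rw [hTdef] at *
      linarith
    rw [hR, le_div_iff₀ hm0]
    rcases hT0.eq_or_lt with h | h
    · rw [← h]; simp
    · refine le_of_mul_le_mul_right (a := T) ?_ h
      linarith
  have e1 := abs_nonneg (τ - σ)
  have e2 := abs_nonneg (x' - y')
  have e3 := abs_le.1 (show |τ - σ| ≤ R by linarith)
  have e4 := abs_le.1 (show |x' - y'| ≤ R by linarith)
  refine hmax (show ((τ, x'), (σ, y')) ∈ B from ?_)
  simp only [hB, mem_prod, mem_Icc]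
  refine ⟨⟨⟨ht0, ht1⟩, hx', by linarith⟩, ⟨?_, ?_⟩, hy', by linarith⟩ <;> linarith

/-- Comparison principle: since `f` is strictly increasing, `x` plays the role of time. -/
theorem viscosity_comparison {f : ℝ → ℝ} {a b : ℝ} {v w : ℝ × ℝ → ℝ} {K : ℝ≥0}
    (hf : StrictMonoOn f (Icc a b)) (hv : LipschitzOnWith K v halfPlane)
    (hw : LipschitzOnWith K w halfPlane) (hvp : ∀ t x : ℝ, 0 ≤ x → v (t + 1, x) = v (t, x))
    (hwp : ∀ t x : ℝ, 0 ≤ x → w (t + 1, x) = w (t, x)) (hvs : HasSlopesIn a b v)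
    (hws : HasSlopesIn a b w) (hsub : IsViscositySubsolution f openHalfPlane v)
    (hsuper : IsViscositySupersolution f openHalfPlane w) (h0 : ∀ t, v (t, 0) = w (t, 0))
    {t₀ x₀ : ℝ} (hx₀ : 0 ≤ x₀) : v (t₀, x₀) ≤ w (t₀, x₀) := by
  by_contra! hlt
  obtain ⟨d, hd⟩ : ∃ d, d = v (t₀, x₀) - w (t₀, x₀) := ⟨_, rfl⟩
  have hd0 : 0 < d := by linarith
  -- `l` costs at most `d / 2` at `x₀`, and `A` keeps boundary values of `doubled` strictly below `d
  -- / 2`; so the maximum is interior.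
  obtain ⟨l, hl⟩ : ∃ l, l = d / (2 * (x₀ ^ 2 + 1)) := ⟨_, rfl⟩
  obtain ⟨A, hA⟩ : ∃ A, A = ((K : ℝ) ^ 2 + 1) / d := ⟨_, rfl⟩
  have hl0 : 0 < l := by rw [hl]; positivity
  have hA0 : 0 < A := by rw [hA]; positivity
  have hlx : l * x₀ ^ 2 ≤ d / 2 := by
    rw [hl, div_mul_eq_mul_div, div_le_div_iff₀ (by positivity) (by positivity)]
    nlinarith
  have hKA : (K : ℝ) ^ 2 / (2 * A) < d / 2 := by
    rw [hA, div_lt_div_iff₀ (by positivity) (by positivity)]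
    field_simp
    linarith
  obtain ⟨t, x, s, y, hx, hy, hmax⟩ := exists_isMax_doubled hv hw hvp hwp h0 hA0 hl0
  have hd1 : d / 2 ≤ doubled v w A l ((t₀, x₀), (t₀, x₀)) := by
    simp only [doubled, sub_self]
    linarith
  have hM := hd1.trans (hmax t₀ x₀ t₀ x₀ hx₀ hx₀ (by linarith))
  have hmax' : ∀ t' x' s' y' : ℝ, 0 ≤ x' → 0 ≤ y' →
      doubled v w A l ((t', x'), (s', y')) ≤ doubled v w A l ((t, x), (s, y)) := by
    intro t' x' s' y' hx' hy'
    rcases le_or_gt (doubled v w A l ((t', x'), (s', y'))) 0 with h | h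
    · linarith
    · exact hmax t' x' s' y' hx' hy' h
  have hint : ¬ (x = 0 ∨ y = 0) := fun h => by
    have := doubled_le_of_boundary hv hw h0 hA0 hl0.le (t := t) (s := s) hx hy h
    linarith
  rw [not_or] at hint
  have hx' : 0 < x := lt_of_le_of_ne hx (Ne.symm hint.1)
  have hy' : 0 < y := lt_of_le_of_ne hy (Ne.symm hint.2)
  set φ : ℝ × ℝ → ℝ := fun z => A * ((z.1 - s) ^ 2 + (z.2 - y) ^ 2) + l * z.2 ^ 2 with hφ
  -- The null term `0 * z.2 ^ 2` lets `fderiv_quadratic_penalty` serve for both test functions.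
  set χ : ℝ × ℝ → ℝ := fun z => -A * ((z.1 - t) ^ 2 + (z.2 - x) ^ 2) + 0 * z.2 ^ 2 with hχ
  have hφc : ContDiff ℝ 1 φ := by rw [hφ]; fun_prop
  have hχc : ContDiff ℝ 1 χ := by rw [hχ]; fun_prop
  have hφmax : IsLocalMax (fun z => v z - φ z) (t, x) := by
    filter_upwards [isOpen_openHalfPlane.mem_nhds (mem_openHalfPlane.2 hx')] with z hz
    have := hmax' z.1 z.2 s y (mem_openHalfPlane.1 hz).le hy
    simp only [doubled, hφ] at this ⊢
    linarith
  have hχmin : IsLocalMin (fun z => w z - χ z) (s, y) := by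
    filter_upwards [isOpen_openHalfPlane.mem_nhds (mem_openHalfPlane.2 hy')] with z hz
    have := hmax' t x z.1 z.2 hx (mem_openHalfPlane.1 hz).le
    simp only [doubled, hχ] at this ⊢
    linarith
  have hφd := (hφc.differentiable (by norm_num)).differentiableAt (x := (t, x))
  have hχd := (hχc.differentiable (by norm_num)).differentiableAt (x := (s, y))
  have h1 := hsub φ hφc.contDiffOn _ (mem_openHalfPlane.2 hx') hφmax
  have h2 := hsuper χ hχc.contDiffOn _ (mem_openHalfPlane.2 hy') hχmin
  have h3 := hvs.fderiv_mem_of_isLocalMax hx' hφd hφmax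
  have h4 := hws.fderiv_mem_of_isLocalMin hy' hχd hχmin
  obtain ⟨e1, e2⟩ := fderiv_quadratic_penalty A l s y t x
  obtain ⟨e3, e4⟩ := fderiv_quadratic_penalty (-A) 0 t x s y
  rw [hφ, e2] at h3
  rw [hχ, e4] at h4
  rw [hφ, e1, e2] at h1
  rw [hχ, e3, e4] at h2
  have hlx' : 0 < l * x := mul_pos hl0 hx'
  -- The slopes are `2 * A * (x - y) + 2 * l * x` for `v` and `2 * A * (x - y)` for `w`, while the
  -- `t`-derivatives agree.
  have h5 := hf h4 h3 (by linarith)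
  linarith

theorem IsPeriodicHJSolution.le {f ψ : ℝ → ℝ} {a b : ℝ} (hf : StrictMonoOn f (Icc a b))
    {v w : ℝ × ℝ → ℝ} (hv : IsPeriodicHJSolution f a b ψ v)
    (hw : IsPeriodicHJSolution f a b ψ w) {t x : ℝ} (hx : 0 ≤ x) : v (t, x) ≤ w (t, x) := by
  obtain ⟨Kv, hKv⟩ := hv.lipschitz
  obtain ⟨Kw, hKw⟩ := hw.lipschitz
  exact viscosity_comparison hf (hKv.weaken (le_max_left Kv Kw)) (hKw.weaken (le_max_right Kv Kw))
    hv.periodic hw.periodic hv.hasSlopesIn hw.hasSlopesIn hv.subsolution hw.supersolution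
    (fun t => (hv.boundary t).trans (hw.boundary t).symm) hx

theorem IsPeriodicHJSolution.eqOn {f ψ : ℝ → ℝ} {a b : ℝ} (hf : StrictMonoOn f (Icc a b))
    {v w : ℝ × ℝ → ℝ} (hv : IsPeriodicHJSolution f a b ψ v)
    (hw : IsPeriodicHJSolution f a b ψ w) : EqOn v w halfPlane := fun z hz =>
  have hz' : 0 ≤ z.2 := hz.2
  le_antisymm (hv.le hf hw hz') (hw.le hf hv hz')

/-! ### The support-type function `xi` -/

section Xi

variable {f : ℝ → ℝ} {a b : ℝ}

theorem le_xi (hab : a ≤ b) (hf : ContinuousOn f (Icc a b)) {p : ℝ} (hp : p ∈ Icc a b)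
    (s y : ℝ) : -p * y + s * f p ≤ xi f a b s y :=
  (isGreatest_xi hab hf s y).2 ⟨p, hp, rfl⟩

theorem xi_le (hab : a ≤ b) (hf : ContinuousOn f (Icc a b)) {s y c : ℝ}
    (h : ∀ p ∈ Icc a b, -p * y + s * f p ≤ c) : xi f a b s y ≤ c := by
  obtain ⟨p, hp, e⟩ := (isGreatest_xi hab hf s y).1
  rw [← e]
  exact h p hp

theorem xi_add_le (hab : a ≤ b) (hf : ContinuousOn f (Icc a b)) (s s' y y' : ℝ) :
    xi f a b (s + s') (y + y') ≤ xi f a b s y + xi f a b s' y' :=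
  xi_le hab hf fun p hp => by
    linarith [le_xi hab hf hp s y, le_xi hab hf hp s' y']

theorem xi_mul_le (hab : a ≤ b) (hf : ContinuousOn f (Icc a b)) {c : ℝ} (hc : 0 ≤ c) (s y : ℝ) :
    xi f a b (c * s) (c * y) ≤ c * xi f a b s y :=
  xi_le hab hf fun p hp => by
    have := mul_le_mul_of_nonneg_left (le_xi hab hf hp s y) hc
    linarith

theorem xi_sub_mem_right (hab : a ≤ b) (hf : ContinuousOn f (Icc a b)) (s : ℝ) {y y' : ℝ}
    (hy : y ≤ y') : xi f a b s y - xi f a b s y' ∈ Icc (a * (y' - y)) (b * (y' - y)) := by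
  have hy' : 0 ≤ y' - y := by linarith
  constructor
  · have : xi f a b s y' ≤ xi f a b s y - a * (y' - y) := xi_le hab hf fun p hp => by
      have := mul_le_mul_of_nonneg_right hp.1 hy'
      linarith [le_xi hab hf hp s y]
    linarith
  · have : xi f a b s y ≤ xi f a b s y' + b * (y' - y) := xi_le hab hf fun p hp => by
      have := mul_le_mul_of_nonneg_right hp.2 hy'
      linarith [le_xi hab hf hp s y']
    linarith

theorem continuous_xi_left (hab : a ≤ b) (hm : MonotoneOn f (Icc a b))
    (hf : ContinuousOn f (Icc a b)) (y : ℝ) : Continuous fun s => xi f a b s y := by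
  have hC : 0 ≤ |f a| + |f b| := by positivity
  refine (LipschitzWith.of_le_add_mul (⟨_, hC⟩ : ℝ≥0) fun s s' => ?_).continuous
  refine xi_le hab hf fun p hp => ?_
  have h1 := hm (left_mem_Icc.2 hab) hp hp.1
  have h2 := hm hp (right_mem_Icc.2 hab) hp.2
  have h3 : |f p| ≤ |f a| + |f b| := by
    rw [abs_le]
    constructor <;> linarith [neg_abs_le (f a), le_abs_self (f b), abs_nonneg (f a),
      abs_nonneg (f b)]
  have h4 : (s - s') * f p ≤ (|f a| + |f b|) * dist s s' := by
    rw [Real.dist_eq, mul_comm]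
    refine (le_abs_self _).trans ?_
    rw [abs_mul]
    gcongr
  have := le_xi hab hf hp s' y
  change _ ≤ _ + (|f a| + |f b|) * dist s s'
  linarith

end Xi

/-! ### Regularity and dynamic programming for the Lax formula -/

/-- The Lax formula `sup_{t₁ ≤ t} (ψ t₁ - ξ (t - t₁, x))`. -/
noncomputable def laxSup (f : ℝ → ℝ) (a b : ℝ) (ψ : ℝ → ℝ) (z : ℝ × ℝ) : ℝ :=
  sSup {r : ℝ | ∃ t₁ : ℝ, t₁ ≤ z.1 ∧ r = ψ t₁ - xi f a b (z.1 - t₁) z.2}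

/-- `ψ` has slopes between `c` and `d`. -/
def HasIncrementsIn (c d : ℝ) (ψ : ℝ → ℝ) : Prop :=
  ∀ s t : ℝ, s ≤ t → ψ t - ψ s ∈ Icc (c * (t - s)) (d * (t - s))

section Lax

variable {f ψ : ℝ → ℝ} {a b : ℝ}

theorem isLUB_laxSup (hab : a ≤ b) (hf : ContinuousOn f (Icc a b))
    (hψ : HasIncrementsIn (-f b) (-f a) ψ) (t x : ℝ) :
    IsLUB {r : ℝ | ∃ t₁ : ℝ, t₁ ≤ t ∧ r = ψ t₁ - xi f a b (t - t₁) x} (laxSup f a b ψ (t, x)) := by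
  -- The bound comes from `p = b` in `xi`, whose term `(t - t₁) * f b` offsets the steepest decrease
  -- of `ψ`.
  refine isLUB_csSup ⟨_, t, le_rfl, rfl⟩ ⟨ψ t + b * x, ?_⟩
  rintro r ⟨t₁, ht, rfl⟩
  have h1 := le_xi hab hf (right_mem_Icc.2 hab) (t - t₁) x
  have h2 := (hψ t₁ t ht).1
  linarith

theorem le_laxSup (hab : a ≤ b) (hf : ContinuousOn f (Icc a b))
    (hψ : HasIncrementsIn (-f b) (-f a) ψ) (t x : ℝ) {s : ℝ} (hs : 0 ≤ s) :
    ψ (t - s) - xi f a b s x ≤ laxSup f a b ψ (t, x) :=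
  (isLUB_laxSup hab hf hψ t x).1 ⟨t - s, by linarith, by rw [sub_sub_cancel]⟩

theorem laxSup_le {t x c : ℝ} (h : ∀ s : ℝ, 0 ≤ s → ψ (t - s) - xi f a b s x ≤ c) :
    laxSup f a b ψ (t, x) ≤ c := by
  refine csSup_le ⟨_, t, le_rfl, rfl⟩ ?_
  rintro r ⟨t₁, ht, rfl⟩
  simpa using h (t - t₁) (by simpa using ht)

theorem laxSup_hasSlopesIn (hab : a ≤ b) (hf : ContinuousOn f (Icc a b))
    (hψ : HasIncrementsIn (-f b) (-f a) ψ) : HasSlopesIn a b (laxSup f a b ψ) := by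
  intro t x y _ hxy
  constructor
  · have : laxSup f a b ψ (t, x) ≤ laxSup f a b ψ (t, y) - a * (y - x) := laxSup_le fun s hs => by
      linarith [(xi_sub_mem_right hab hf s hxy).1, le_laxSup hab hf hψ t y hs]
    linarith
  · have : laxSup f a b ψ (t, y) ≤ laxSup f a b ψ (t, x) + b * (y - x) := laxSup_le fun s hs => by
      linarith [(xi_sub_mem_right hab hf s hxy).2, le_laxSup hab hf hψ t x hs]
    linarith

/-- With `s = t - t₁` as the variable, `t` enters only through `ψ (t - s)`, so the slope bounds of
`ψ` pass to the supremum. -/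
theorem laxSup_hasIncrementsIn (hab : a ≤ b) (hf : ContinuousOn f (Icc a b))
    (hψ : HasIncrementsIn (-f b) (-f a) ψ) (x : ℝ) :
    HasIncrementsIn (-f b) (-f a) (fun t => laxSup f a b ψ (t, x)) := by
  intro t t' ht
  have key : ∀ s, ψ (t' - s) - ψ (t - s) ∈ Icc (-f b * (t' - t)) (-f a * (t' - t)) := fun s => by
    simpa using hψ (t - s) (t' - s) (by linarith)
  constructor
  · have : laxSup f a b ψ (t, x) ≤ laxSup f a b ψ (t', x) - -f b * (t' - t) :=
      laxSup_le fun s hs => by linarith [(key s).1, le_laxSup hab hf hψ t' x hs]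
    linarith
  · have : laxSup f a b ψ (t', x) ≤ laxSup f a b ψ (t, x) + -f a * (t' - t) :=
      laxSup_le fun s hs => by linarith [(key s).2, le_laxSup hab hf hψ t x hs]
    linarith

theorem abs_sub_le_of_hasIncrementsIn {c d : ℝ} {g : ℝ → ℝ} (hg : HasIncrementsIn c d g)
    (s t : ℝ) : |g t - g s| ≤ (|c| + |d|) * |t - s| := by
  wlog hst : s ≤ t generalizing s t
  · rw [abs_sub_comm, abs_sub_comm t s]
    exact this t s (le_of_not_ge hst)
  have h := hg s t hst
  have h0 : 0 ≤ t - s := by linarith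
  have hc := mul_le_mul_of_nonneg_right (neg_abs_le c) h0
  have hd := mul_le_mul_of_nonneg_right (le_abs_self d) h0
  have hc' := mul_nonneg (abs_nonneg c) h0
  have hd' := mul_nonneg (abs_nonneg d) h0
  rw [abs_of_nonneg h0, abs_le]
  constructor <;> linarith [h.1, h.2]

theorem laxSup_lipschitzOnWith (hab : a ≤ b) (hf : ContinuousOn f (Icc a b))
    (hψ : HasIncrementsIn (-f b) (-f a) ψ) :
    ∃ K : ℝ≥0, LipschitzOnWith K (laxSup f a b ψ) halfPlane := by
  have hC : 0 ≤ (|-f b| + |-f a|) + (|a| + |b|) := by positivity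
  refine ⟨⟨_, hC⟩, LipschitzOnWith.of_dist_le_mul ?_⟩
  rintro ⟨t, x⟩ hz ⟨s, y⟩ hz'
  change _ ≤ ((|-f b| + |-f a|) + (|a| + |b|)) * _
  have hx := mem_halfPlane.1 hz
  have hy := mem_halfPlane.1 hz'
  have h1 := abs_sub_le_of_hasIncrementsIn (laxSup_hasIncrementsIn hab hf hψ x) s t
  have h2 : |laxSup f a b ψ (s, x) - laxSup f a b ψ (s, y)| ≤ (|a| + |b|) * |x - y| := by
    have hs := laxSup_hasSlopesIn hab hf hψ
    -- Extension to negative `x` with slope `a`, so that the estimate on all of `ℝ` applies.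
    have hmax : HasIncrementsIn a b
        (fun r => laxSup f a b ψ (s, max r 0) + (a * min r 0)) := by
      intro r r' hr
      rcases le_total r 0 with h | h <;> rcases le_total r' 0 with h' | h'
      · have := mul_le_mul_of_nonneg_right hab (sub_nonneg.2 hr)
        simp only [max_eq_right h, max_eq_right h', min_eq_left h, min_eq_left h', mem_Icc]
        constructor <;> linarith
      · have := hs s 0 r' le_rfl h'
        have h3 := mul_le_mul_of_nonneg_right hab (neg_nonneg.2 h)
        simp only [max_eq_right h, max_eq_left h', min_eq_left h, min_eq_right h', mem_Icc] at this ⊢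
        constructor <;> linarith
      · have e : r = r' := by linarith
        subst e
        simp
      · have := hs s r r' h hr
        simp only [max_eq_left h, max_eq_left h', min_eq_right h, min_eq_right h', mem_Icc] at this ⊢
        constructor <;> linarith
    simpa [max_eq_left hx, max_eq_left hy, min_eq_right hx, min_eq_right hy] using
      abs_sub_le_of_hasIncrementsIn hmax y x
  rw [Real.dist_eq, Prod.dist_eq, Real.dist_eq, Real.dist_eq]
  have h3 := abs_sub_le (laxSup f a b ψ (t, x)) (laxSup f a b ψ (s, x)) (laxSup f a b ψ (s, y))
  refine h3.trans ((add_le_add h1 h2).trans ?_)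
  rw [add_mul _ (|a| + |b|)]
  gcongr
  · exact le_max_left _ _
  · exact le_max_right _ _

theorem laxSup_periodic (hab : a ≤ b) (hf : ContinuousOn f (Icc a b))
    (hψ : HasIncrementsIn (-f b) (-f a) ψ) (hp : Function.Periodic ψ 1) (t x : ℝ) :
    laxSup f a b ψ (t + 1, x) = laxSup f a b ψ (t, x) := by
  have key : ∀ s, ψ (t + 1 - s) = ψ (t - s) := fun s => by
    rw [add_sub_right_comm, hp]
  refine le_antisymm (laxSup_le fun s hs => ?_) (laxSup_le fun s hs => ?_)
  · rw [key]
    exact le_laxSup hab hf hψ t x hs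
  · rw [← key]
    exact le_laxSup hab hf hψ (t + 1) x hs

theorem laxSup_zero (hab : a ≤ b) (hf : ContinuousOn f (Icc a b))
    (hψ : HasIncrementsIn (-f b) (-f a) ψ) (t : ℝ) : laxSup f a b ψ (t, 0) = ψ t := by
  refine le_antisymm (laxSup_le fun s hs => ?_) ?_
  · have h1 := le_xi hab hf (right_mem_Icc.2 hab) s 0
    have h2 := (hψ (t - s) t (by linarith)).1
    linarith
  · have h1 : xi f a b 0 0 ≤ 0 := xi_le hab hf fun p _ => by simp
    have h2 := le_laxSup hab hf hψ t 0 le_rfl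
    rw [sub_zero] at h2
    linarith

/-- The easy half of dynamic programming, from subadditivity of `xi`. -/
theorem laxSup_sub_xi_le (hab : a ≤ b) (hf : ContinuousOn f (Icc a b))
    (hψ : HasIncrementsIn (-f b) (-f a) ψ) {s : ℝ} (hs : 0 ≤ s) (t x h : ℝ) :
    laxSup f a b ψ (t - s, x - h) - xi f a b s h ≤ laxSup f a b ψ (t, x) := by
  rw [sub_le_iff_le_add]
  refine laxSup_le fun r hr => ?_
  have h1 := le_laxSup hab hf hψ t x (add_nonneg hs hr)
  have h2 := xi_add_le hab hf s r h (x - h)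
  rw [add_sub_cancel] at h2
  rw [sub_sub]
  linarith

/-- Along a straight optimal trajectory the value decreases at the rate `ξ`. -/
theorem laxSup_le_of_optimal (hab : a ≤ b) (hf : ContinuousOn f (Icc a b))
    (hψ : HasIncrementsIn (-f b) (-f a) ψ) {t x s θ : ℝ} (hs : 0 ≤ s)
    (hopt : laxSup f a b ψ (t, x) = ψ (t - s) - xi f a b s x) (h1 : θ ≤ 1) :
    xi f a b s x * θ ≤ laxSup f a b ψ (t - θ * s, x - θ * x) - laxSup f a b ψ (t, x) := by
  have h1' : 0 ≤ 1 - θ := by linarith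
  have h2 := le_laxSup hab hf hψ (t - θ * s) (x - θ * x) (mul_nonneg h1' hs)
  have h3 := xi_mul_le hab hf h1' s x
  rw [show t - θ * s - (1 - θ) * s = t - s by ring] at h2
  rw [show (1 - θ) * x = x - θ * x by ring] at h3
  rw [hopt]
  linarith

/-- By periodicity `ψ` is bounded above, while `xi f a b s x` is at least `s * f b - b * x`. As `0 <
f b`, large `s` cannot beat `s = 0`, and compactness gives a maximiser. -/
theorem exists_optimal_laxSup (hab : a ≤ b) (hm : MonotoneOn f (Icc a b))
    (hf : ContinuousOn f (Icc a b)) (hψ : HasIncrementsIn (-f b) (-f a) ψ)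
    (hc : Continuous ψ) (hp : Function.Periodic ψ 1) (hfb : 0 < f b) (t x : ℝ) :
    ∃ s : ℝ, 0 ≤ s ∧ laxSup f a b ψ (t, x) = ψ (t - s) - xi f a b s x := by
  have hbd : ∀ u, ψ u ≤ ψ 0 + |f a| := fun u => by
    have e : ψ (Int.fract u) = ψ u := by
      have h := hp.sub_int_mul_eq ⌊u⌋ (x := u)
      rwa [mul_one] at h
    have h1 := (hψ 0 (Int.fract u) (Int.fract_nonneg u)).2
    have h2 : -f a * (Int.fract u - 0) ≤ |f a| * 1 := by
      rw [sub_zero]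
      exact mul_le_mul (neg_le_abs _) (Int.fract_lt_one u).le (Int.fract_nonneg u) (abs_nonneg _)
    linarith
  set g : ℝ → ℝ := fun s => ψ (t - s) - xi f a b s x with hg
  have hgc : Continuous g := by
    have := continuous_xi_left hab hm hf x
    fun_prop
  set C := ψ 0 + |f a| + b * x - g 0 with hC
  obtain ⟨s, hs, hmax⟩ := (isCompact_Icc (a := (0 : ℝ)) (b := |C| / f b)).exists_isMaxOn
    (nonempty_Icc.2 (by positivity)) hgc.continuousOn
  refine ⟨s, hs.1, le_antisymm (laxSup_le fun r hr => ?_) (le_laxSup hab hf hψ t x hs.1)⟩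
  rcases le_or_gt r (|C| / f b) with h | h
  · exact hmax ⟨hr, h⟩
  · have h1 : g r ≤ g 0 := by
      rw [div_lt_iff₀ hfb] at h
      have h2 := le_xi hab hf (right_mem_Icc.2 hab) r x
      have h3 := hbd (t - r)
      have h4 := le_abs_self C
      simp only [hg] at hC ⊢
      linarith
    exact h1.trans (hmax ⟨le_rfl, by positivity⟩)

/-! ### The Lax formula solves the equation -/

theorem differentiableAt_of_contDiffOn_openHalfPlane {φ : ℝ × ℝ → ℝ} {z : ℝ × ℝ}
    (hφ : ContDiffOn ℝ 1 φ openHalfPlane) (hz : z ∈ openHalfPlane) : DifferentiableAt ℝ φ z :=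
  (hφ.differentiableOn (by norm_num)).differentiableAt (isOpen_openHalfPlane.mem_nhds hz)

theorem ContinuousLinearMap.apply_real_prod (L : ℝ × ℝ →L[ℝ] ℝ) (s y : ℝ) :
    L (s, y) = s * L (1, 0) + y * L (0, 1) := by
  have : ((s, y) : ℝ × ℝ) = s • (1, 0) + y • (0, 1) := by simp
  rw [this, map_add, map_smul, map_smul, smul_eq_mul, smul_eq_mul]

theorem laxSup_supersolution (hab : a ≤ b) (hm : MonotoneOn f (Icc a b))
    (hconc : ConcaveOn ℝ (Icc a b) f) (hd : DifferentiableOn ℝ f (Icc a b))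
    (hψ : HasIncrementsIn (-f b) (-f a) ψ) :
    IsViscositySupersolution f openHalfPlane (laxSup f a b ψ) := by
  have hf := hd.continuousOn
  rintro φ hφ ⟨t, x⟩ hz hmin
  have hx := mem_openHalfPlane.1 hz
  have hφd := differentiableAt_of_contDiffOn_openHalfPlane hφ hz
  have hp := (laxSup_hasSlopesIn hab hf hψ).fderiv_mem_of_isLocalMin hx hφd hmin
  obtain ⟨m, _, hmp⟩ := exists_nonneg_supergradient hm hconc hd hp
  -- For a supergradient `m` at the contact slope `p`, the maximum in `xi f a b 1 m` is attained at
  -- `p`, so the direction `(-1, -m)` yields exactly the equation's inequality.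
  have h : fderiv ℝ φ (t, x) (-1, -m) ≤ xi f a b 1 m := by
    refine fderiv_le_of_isLocalMin hφd hmin (Eventually.frequently ?_)
    filter_upwards [self_mem_nhdsWithin] with h hh
    have hh' : 0 ≤ h := le_of_lt hh
    have h1 := laxSup_sub_xi_le hab hf hψ hh' t x (h * m)
    have h2 := xi_mul_le hab hf hh' 1 m
    rw [mul_one] at h2
    simp only [Prod.smul_mk, smul_eq_mul, mul_neg, mul_one, Prod.mk_add_mk, ← sub_eq_add_neg]
    linarith
  have h2 : xi f a b 1 m ≤ f (fderiv ℝ φ (t, x) (0, 1)) - m * fderiv ℝ φ (t, x) (0, 1) :=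
    xi_le hab hf fun p' hp' => by linarith [hmp p' hp']
  rw [ContinuousLinearMap.apply_real_prod] at h
  linarith

theorem laxSup_subsolution (hab : a ≤ b) (hm : MonotoneOn f (Icc a b))
    (hf : ContinuousOn f (Icc a b)) (hψ : HasIncrementsIn (-f b) (-f a) ψ)
    (hc : Continuous ψ) (hper : Function.Periodic ψ 1) :
    IsViscositySubsolution f openHalfPlane (laxSup f a b ψ) := by
  rintro φ hφ ⟨t, x⟩ hz hmax
  have hx := mem_openHalfPlane.1 hz
  have hφd := differentiableAt_of_contDiffOn_openHalfPlane hφ hz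
  have hp := (laxSup_hasSlopesIn hab hf hψ).fderiv_mem_of_isLocalMax hx hφd hmax
  have hinc := laxSup_hasIncrementsIn hab hf hψ x
  have hfb : 0 ≤ f b := by
    have h1 := (hψ 0 1 zero_le_one).1
    have h2 := hper 0
    rw [zero_add] at h2
    linarith
  -- If `f b = 0`, an optimal `s` may fail to exist; but then the value is nondecreasing and
  -- periodic in `t`, and `f ≤ 0` on `[a, b]`.
  rcases hfb.eq_or_lt with h0 | h0
  · have hq : 0 ≤ fderiv ℝ φ (t, x) (-1, 0) := by
      refine le_fderiv_of_isLocalMax hφd hmax (Eventually.frequently ?_)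
      filter_upwards [eventually_nhdsGT_zero_le one_pos] with h hh
      have h1 := (hinc (t - 1) (t - h) (by linarith)).1
      have h2 := laxSup_periodic hab hf hψ hper (t - 1) x
      simp only [sub_add_cancel, ← h0, neg_zero, zero_mul] at h1 h2
      simp only [Prod.smul_mk, smul_eq_mul, mul_neg, mul_one, mul_zero, Prod.mk_add_mk, add_zero,
        ← sub_eq_add_neg, zero_mul]
      linarith
    have h1 := hm hp (right_mem_Icc.2 hab) hp.2
    rw [ContinuousLinearMap.apply_real_prod] at hq
    linarith
  obtain ⟨s, hs, hopt⟩ := exists_optimal_laxSup hab hm hf hψ hc hper h0 t x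
  have h1 : xi f a b s x ≤ fderiv ℝ φ (t, x) (-s, -x) := by
    refine le_fderiv_of_isLocalMax hφd hmax (Eventually.frequently ?_)
    filter_upwards [eventually_nhdsGT_zero_le one_pos] with θ hθ
    have := laxSup_le_of_optimal hab hf hψ hs hopt hθ.2
    simpa only [Prod.smul_mk, smul_eq_mul, mul_neg, Prod.mk_add_mk, ← sub_eq_add_neg] using this
  rw [ContinuousLinearMap.apply_real_prod] at h1
  -- If `s = 0`, the optimal segment carries no information on `∂ₜ φ`: it forces the slope `a`, and
  -- the bound `-f a` on `t`-increments finishes. Otherwise the inequality is divided by `s`.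
  rcases hs.eq_or_lt with rfl | hs'
  · have h2 := le_xi hab hf (left_mem_Icc.2 hab) 0 x
    have hpa : fderiv ℝ φ (t, x) (0, 1) = a := by
      refine le_antisymm (le_of_mul_le_mul_left ?_ hx) hp.1
      linarith
    have hq : f a ≤ fderiv ℝ φ (t, x) (-1, 0) := by
      refine le_fderiv_of_isLocalMax hφd hmax (Eventually.frequently ?_)
      filter_upwards [self_mem_nhdsWithin] with h hh
      have hh' : 0 < h := hh
      have h1 := (hinc (t - h) t (by linarith)).2
      simp only [sub_sub_cancel] at h1
      simp only [Prod.smul_mk, smul_eq_mul, mul_neg, mul_one, mul_zero, Prod.mk_add_mk, add_zero,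
        ← sub_eq_add_neg]
      linarith
    rw [ContinuousLinearMap.apply_real_prod] at hq
    rw [hpa]
    linarith
  · have h2 := le_xi hab hf hp s x
    refine le_of_mul_le_mul_left ?_ hs'
    linarith

theorem laxSup_slope_mem (hab : a ≤ b) (hf : ContinuousOn f (Icc a b))
    (hψ : HasIncrementsIn (-f b) (-f a) ψ) :
    ∀ᵐ z ∂(volume.restrict openHalfPlane),
      ∃ p ∈ Icc a b, HasDerivAt (fun y => laxSup f a b ψ (z.1, y)) p z.2 := by
  obtain ⟨K, hK⟩ := laxSup_lipschitzOnWith hab hf hψ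
  have hsub : openHalfPlane ⊆ halfPlane := prod_mono subset_rfl Ioi_subset_Ici_self
  filter_upwards [(hK.mono hsub).ae_differentiableWithinAt isOpen_openHalfPlane.measurableSet,
    ae_restrict_mem isOpen_openHalfPlane.measurableSet] with z hdz hz
  obtain ⟨t, x⟩ := z
  have hda := hdz.differentiableAt (isOpen_openHalfPlane.mem_nhds hz)
  -- At a point of differentiability, given a.e. by Rademacher, the function serves as its own test
  -- function.
  refine ⟨fderiv ℝ (laxSup f a b ψ) (t, x) (0, 1),
    (laxSup_hasSlopesIn hab hf hψ).fderiv_mem_of_isLocalMax (mem_openHalfPlane.1 hz) hda ?_, ?_⟩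
  · exact Eventually.of_forall fun y => by simp
  · exact hda.hasFDerivAt.comp_hasDerivAt x ((hasDerivAt_const x t).prodMk (hasDerivAt_id x))

theorem isPeriodicHJSolution_laxSup (hab : a ≤ b) (hm : MonotoneOn f (Icc a b))
    (hconc : ConcaveOn ℝ (Icc a b) f) (hd : DifferentiableOn ℝ f (Icc a b))
    (hψ : HasIncrementsIn (-f b) (-f a) ψ) (hc : Continuous ψ) (hper : Function.Periodic ψ 1) :
    IsPeriodicHJSolution f a b ψ (laxSup f a b ψ) where
  lipschitz := laxSup_lipschitzOnWith hab hd.continuousOn hψ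
  periodic t x _ := laxSup_periodic hab hd.continuousOn hψ hper t x
  slope_mem := laxSup_slope_mem hab hd.continuousOn hψ
  subsolution := laxSup_subsolution hab hm hd.continuousOn hψ hc hper
  supersolution := laxSup_supersolution hab hm hconc hd hψ
  boundary := laxSup_zero hab hd.continuousOn hψ

end Lax

theorem lemma3p1 (a b : ℝ) (hab : a < b) (f : ℝ → ℝ)
    (hf_mono : StrictMonoOn f (Icc a b))
    (hf_C2 : ContDiffOn ℝ 2 f (Icc a b))
    (hf_conc : ∃ δ : ℝ, 0 < δ ∧ ∀ p ∈ Icc a b, iteratedDerivWithin 2 f (Icc a b) p ≤ -δ)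
    (ψ : ℝ → ℝ)
    (hψ_lip : ∃ K : ℝ≥0, LipschitzWith K ψ)
    (hψ_per : Function.Periodic ψ 1)
    (hψ_deriv : ∀ᵐ t : ℝ, deriv ψ t ∈ Icc (-f b) (-f a)) :
    ∃ w : ℝ × ℝ → ℝ,
      IsPeriodicHJSolution f a b ψ w ∧
      (∀ v : ℝ × ℝ → ℝ, IsPeriodicHJSolution f a b ψ v → EqOn v w halfPlane) ∧
      ∀ t x : ℝ, 0 ≤ x →
        IsLUB {r : ℝ | ∃ t₁ : ℝ, t₁ ≤ t ∧ r = ψ t₁ - xi f a b (t - t₁) x} (w (t, x)) := by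
  obtain ⟨δ, hδ, hδf⟩ := hf_conc
  obtain ⟨K, hK⟩ := hψ_lip
  have hconc : ConcaveOn ℝ (Icc a b) f := concaveOn_Icc_of_iteratedDerivWithin_two_nonpos hab hf_C2
    fun p hp => (hδf p hp).trans (by linarith)
  have hψ : HasIncrementsIn (-f b) (-f a) ψ := fun _ _ hst => hK.sub_mem_Icc_of_ae_deriv hst hψ_deriv
  have hsol := isPeriodicHJSolution_laxSup hab.le hf_mono.monotoneOn hconc
    (hf_C2.differentiableOn (by norm_num)) hψ hK.continuous hψ_per
  exact ⟨_, hsol, fun v hv => hv.eqOn hf_mono hsol,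
    fun t x _ => isLUB_laxSup hab.le hf_C2.continuousOn hψ t x⟩
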